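/- Let $(M,g)$ be a connected smooth Lorentzian manifold (without boundary), i.e. $g$ is a smooth symmetric $(0,2)$-tensor field of signature $(1,q)$ on each tangent space (one timelike direction). Let $$S^{-}(M,g)=\{\xi\in TM: g(\xi,\xi)=-1\},\qquad S^{+}(M,g)=\{\xi\in TM: g(\xi,\xi)=+1\}$$ be the bundles of unit timelike and unit spacelike tangent vectors. Suppose that $(M,g)$ is a local $2$-point homogeneous space, i.e. the local isometries of $(M,g)$ (smooth diffeomorphisms between open subsets of $M$ preserving $g$) act transitively, through their differentials, on $S^{-}(M,g)$ and on $S^{+}(M,g)$: for any $\xi\in T_pM$ and $\eta\in T_qM$ which both lie in $S^{-}(M,g)$, or both lie in $S^{+}(M,g)$, there is a local isometry $f$ defined near $p$ with $f(p)=q$ and $df_p(\xi)=\eta$. Then $(M,g)$ has constant sectional curvature: there is a constant $c\in\mathbb{R}$ such that, for every $p\in M$ and all $u,v\in T_pM$ with $g(u,u)g(v,v)-g(u,v)^2\neq 0$, $$\frac{g(R(u,v)v,u)}{g(u,u)g(v,v)-g(u,v)^2}=c,$$ where $R(X,Y)=[\nabla_X,\nabla_Y]-\nabla_{[X,Y]}$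 is the curvature operator of the Levi-Civita connection $\nabla$ of $g$. -/

import Mathlib

open scoped Manifold ContDiff Bundle

noncomputable section

/-- A smooth Lorentzian metric on a smooth manifold `M` (without boundary) modelled on the
finite-dimensional real vector space `E`: a smooth symmetric `(0,2)` tensor field whose value on
every tangent space has signature `(1, q)`. -/
structure LorentzianMetric (E : Type*) [NormedAddCommGroup E] [NormedSpace ℝ E]
    (M : Type*) [TopologicalSpace M] [ChartedSpace E M] [IsManifold 𝓘(ℝ, E) ∞ M] where
  /-- the inner product on the tangent space at `x` -/
  inner (x : M) : TangentSpace 𝓘(ℝ, E) x →L[ℝ] TangentSpace 𝓘(ℝ, E) x →L[ℝ] ℝ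
  symm (x : M) (v w : TangentSpace 𝓘(ℝ, E) x) : inner x v w = inner x w v
  /-- Signature `(1, q)`: there is a timelike vector whose orthogonal complement is
  positive definite. -/
  lorentzian (x : M) : ∃ e : TangentSpace 𝓘(ℝ, E) x, inner x e e < 0 ∧
    ∀ w : TangentSpace 𝓘(ℝ, E) x, inner x e w = 0 → w ≠ 0 → 0 < inner x w w
  contMDiff : ContMDiff 𝓘(ℝ, E) (𝓘(ℝ, E).prod 𝓘(ℝ, E →L[ℝ] E →L[ℝ] ℝ)) ∞
    (fun x ↦ Bundle.TotalSpace.mk' (E →L[ℝ] E →L[ℝ] ℝ) x (inner x))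

/-! ### Curvature of a metric on an open subset of a vector space

`G y` is the inner product at the point `y`; all formulas are written with constant vector fields
(linear coordinates). -/
namespace CoordMetric

variable {E : Type*} [NormedAddCommGroup E] [NormedSpace ℝ E]

/-- Christoffel symbols of the first kind, as a linear form in the last argument:
`christoffelFirst G y u v w = (∂_u G(v, w) + ∂_v G(u, w) - ∂_w G(u, v)) / 2` at `y`. -/
def christoffelFirst (G : E → E →L[ℝ] E →L[ℝ] ℝ) (y u v : E) : E →L[ℝ] ℝ :=
  (1 / 2 : ℝ) • (fderiv ℝ G y u v + fderiv ℝ G y v u - ((fderiv ℝ G y).flip u).flip v)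

/-- Christoffel symbols of the second kind: `christoffel G y u v` is the Levi-Civita derivative at
`y` of the constant field `v` in the direction `u`. It is `christoffelFirst G y u v` with the index
raised by `G y` (an invertible map from `E` to its dual when `G y` is nondegenerate). -/
def christoffel (G : E → E →L[ℝ] E →L[ℝ] ℝ) (y u v : E) : E :=
  (G y).inverse (christoffelFirst G y u v)

/-- The curvature operator `R(u, v) z = ∇_u ∇_v z - ∇_v ∇_u z` at `y`, for constant fields
`u, v, z`, where `∇_u Y = ∂_u Y + Γ(u, Y)`. -/
def curvature (G : E → E →L[ℝ] E →L[ℝ] ℝ) (y u v z : E) : E :=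
  (fderiv ℝ (fun y' ↦ christoffel G y' v z) y u + christoffel G y u (christoffel G y v z)) -
    (fderiv ℝ (fun y' ↦ christoffel G y' u z) y v + christoffel G y v (christoffel G y u z))

end CoordMetric

namespace LorentzianMetric

variable {E : Type*} [NormedAddCommGroup E] [NormedSpace ℝ E]
  {M : Type*} [TopologicalSpace M] [ChartedSpace E M] [IsManifold 𝓘(ℝ, E) ∞ M]
  (g : LorentzianMetric E M)

/-- The expression of the metric in the chart around `p`, i.e. its pull-back by the inverse of
the chart. Only points `y` of the (open) image of the chart are meaningful. -/
def inChart (p : M) (y : E) : E →L[ℝ] E →L[ℝ] ℝ :=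
  let B : E →L[ℝ] E →L[ℝ] ℝ := g.inner ((extChartAt 𝓘(ℝ, E) p).symm y)
  let D : E →L[ℝ] E := mfderiv 𝓘(ℝ, E) 𝓘(ℝ, E) (extChartAt 𝓘(ℝ, E) p).symm y
  B.bilinearComp D D

/-- The Riemann curvature tensor `R(u, v, z, w) = g(R(u, v) z, w)` of the Levi-Civita connection at
`p`, where `R(u, v) = [∇_u, ∇_v] - ∇_[u, v]`, computed in the chart around `p`. -/
def riemann (p : M) (u v z w : TangentSpace 𝓘(ℝ, E) p) : ℝ :=
  let y : E := extChartAt 𝓘(ℝ, E) p p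
  let D : TangentSpace 𝓘(ℝ, E) p →L[ℝ] E :=
    mfderiv 𝓘(ℝ, E) 𝓘(ℝ, E) (extChartAt 𝓘(ℝ, E) p) p
  g.inChart p y (CoordMetric.curvature (g.inChart p) y (D u) (D v) (D z)) (D w)

/-- The Gram determinant of `u, v`. It is nonzero exactly when `u, v` span a two-dimensional
subspace on which the metric is nondegenerate. -/
def gram (p : M) (u v : TangentSpace 𝓘(ℝ, E) p) : ℝ :=
  g.inner p u u * g.inner p v v - g.inner p u v ^ 2

/-- The sectional curvature of the nondegenerate plane spanned by `u, v`. -/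
def sectionalCurvature (p : M) (u v : TangentSpace 𝓘(ℝ, E) p) : ℝ :=
  g.riemann p u v v u / g.gram p u v

/-- All nondegenerate tangent planes, at all points, have the same sectional curvature. -/
def HasConstantSectionalCurvature : Prop :=
  ∃ c : ℝ, ∀ (p : M) (u v : TangentSpace 𝓘(ℝ, E) p),
    g.gram p u v ≠ 0 → g.sectionalCurvature p u v = c

/-- A local isometry of `(M, g)`: a smooth diffeomorphism between open subsets of `M`
(its source and its target) preserving the metric. -/
structure IsLocalIsometry (f : OpenPartialHomeomorph M M) : Prop where
  contMDiffOn : ContMDiffOn 𝓘(ℝ, E) 𝓘(ℝ, E) ∞ f f.source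
  contMDiffOn_symm : ContMDiffOn 𝓘(ℝ, E) 𝓘(ℝ, E) ∞ f.symm f.target
  inner_map : ∀ x ∈ f.source, ∀ v w : TangentSpace 𝓘(ℝ, E) x,
    g.inner (f x) (mfderiv 𝓘(ℝ, E) 𝓘(ℝ, E) f x v) (mfderiv 𝓘(ℝ, E) 𝓘(ℝ, E) f x w)
      = g.inner x v w

/-- The bundle `S⁻(M, g)` of unit timelike tangent vectors. -/
def unitTimelike : Set (TangentBundle 𝓘(ℝ, E) M) :=
  {ξ | g.inner ξ.proj ξ.snd ξ.snd = -1}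

/-- The bundle `S⁺(M, g)` of unit spacelike tangent vectors. -/
def unitSpacelike : Set (TangentBundle 𝓘(ℝ, E) M) :=
  {ξ | g.inner ξ.proj ξ.snd ξ.snd = 1}

/-- The local isometries of `(M, g)` act transitively, through their differentials, on the set
`S` of tangent vectors. -/
def LocalIsometriesTransitiveOn (S : Set (TangentBundle 𝓘(ℝ, E) M)) : Prop :=
  ∀ ξ ∈ S, ∀ η ∈ S, ∃ f : OpenPartialHomeomorph M M, g.IsLocalIsometry f ∧
    ξ.proj ∈ f.source ∧ tangentMap 𝓘(ℝ, E) 𝓘(ℝ, E) f ξ = η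

/-- `(M, g)` is a local 2-point homogeneous space. -/
def IsLocalTwoPointHomogeneous : Prop :=
  g.LocalIsometriesTransitiveOn g.unitTimelike ∧ g.LocalIsometriesTransitiveOn g.unitSpacelike

end LorentzianMetric

end

/-! The argument rests on transitivity on unit timelike vectors. A local isometry preserves the
curvature tensor, so its differential is a linear isometry of tangent spaces carrying `R` to `R`,
and any unit timelike vector can be carried to any other.

Fix a unit timelike `e` at a point. Its orthogonal complement is positive definite, so by
compactness the Jacobi form `y ↦ R(y,e,e,y)` is bounded there by `C * g(y,y)`. By transitivity and
scaling, the same `C` gives `|R(y,u,u,y)| ≤ C * g(y,y) * (-g(u,u))` for every timelike `u`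
orthogonal to `y` (`exists_timelike_bound`). The light cone bounds the timelike cone, and the right
side vanishes on it: hence `R(y,n,n,y) = 0` for the null limits `n = √g(x,x) e ± x`, with `x`, `y`
orthogonal to each other and to `e`.

Adding and subtracting the two signs kills the mixed terms and gives `R(y,x,x,y) = -g(x,x)
R(y,e,e,y)`. Exchanging `x` and `y` shows that the Jacobi form of `e` is proportional to the metric,
and every sectional curvature at the point is then the same number
(`exists_const_sectional_of_timelike_bound`). Linear isometries between tangent spaces carry this
number to all other points. -/

open scoped Topology

set_option maxSynthPendingDepth 3

/-! ### Curvature forms on a Lorentzian vector space -/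

section CurvatureAlgebra

variable {V : Type*} [NormedAddCommGroup V] [NormedSpace ℝ V]
  {B : V →L[ℝ] V →L[ℝ] ℝ} {R : V →L[ℝ] V →L[ℝ] V →L[ℝ] V →L[ℝ] ℝ} {e : V} {C : ℝ}

/-- If the sectional curvature of timelike planes is bounded, the curvature form vanishes on
degenerate planes; this is spelled out for the null vectors `√(B x x) • e ± x`. -/
theorem curvatureForm_of_timelike_bound (hB : ∀ v w, B v w = B w v) (he : B e e = -1)
    (hC : ∀ u y, B u u < 0 → B u y = 0 → |R y u u y| ≤ C * (B y y * -(B u u)))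
    {x y : V} (hx : B e x = 0) (hxx : 0 < B x x) (hy : B e y = 0) (hxy : B x y = 0) :
    R y e x y + R y x e y = 0 ∧ R y x x y = - (B x x * R y e e y) := by
  set r := √(B x x) with hr
  have hr0 : 0 < r := Real.sqrt_pos.2 hxx
  have hrr : r * r = B x x := Real.mul_self_sqrt hxx.le
  have hxe : B x e = 0 := by rw [hB, hx]
  -- The vector `r • e + s • x` has square `-r²(1 - s²)`, so it is timelike exactly for `|s| < 1`
  -- and null at `s = ±1`.
  have bound : ∀ s ∈ Set.Ioo (-1 : ℝ) 1,
      |r * r * R y e e y + s * r * (R y e x y + R y x e y) + s * s * R y x x y|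
        ≤ C * (B y y * (r * r * (1 - s * s))) := by
    intro s hs
    have h1 : B (r • e + s • x) (r • e + s • x) = -(r * r * (1 - s * s)) := by
      simp only [map_add, map_smul, add_apply, smul_apply, smul_eq_mul, he,
        hx, hxe]
      rw [← hrr]; ring
    have h2 : B (r • e + s • x) y = 0 := by simp [hy, hxy]
    have h3 : 0 < r * r * (1 - s * s) := by
      apply mul_pos (mul_pos hr0 hr0)
      nlinarith [hs.1, hs.2]
    have h4 := hC _ y (by rw [h1]; linarith) h2
    rw [h1, neg_neg] at h4
    convert h4 using 2
    simp only [map_add, map_smul, add_apply, smul_apply, smul_eq_mul]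
    ring
  -- Both sides are continuous in `s`, so the bound survives at `s = ±1`, where its right side is
  -- zero.
  have closed : ∀ s ∈ Set.Icc (-1 : ℝ) 1,
      |r * r * R y e e y + s * r * (R y e x y + R y x e y) + s * s * R y x x y|
        ≤ C * (B y y * (r * r * (1 - s * s))) := by
    have hcl := closure_minimal (s := Set.Ioo (-1 : ℝ) 1) (t := {s : ℝ |
      |r * r * R y e e y + s * r * (R y e x y + R y x e y) + s * s * R y x x y|
        ≤ C * (B y y * (r * r * (1 - s * s)))}) bound
      (isClosed_le (by fun_prop) (by fun_prop))
    rwa [closure_Ioo (by norm_num)] at hcl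
  have hp := closed 1 (by norm_num)
  have hm := closed (-1) (by norm_num)
  norm_num at hp hm
  have hb : r * (R y e x y + R y x e y) = 0 := by linarith
  refine ⟨(mul_eq_zero.1 hb).resolve_left hr0.ne', ?_⟩
  rw [← hrr]; linarith

/-- An algebraic curvature form on a Lorentzian vector space whose sectional curvatures on timelike
planes are bounded has constant sectional curvature. -/
theorem exists_const_sectional_of_timelike_bound (hB : ∀ v w, B v w = B w v) (he : B e e = -1)
    (hpos : ∀ w, B e w = 0 → w ≠ 0 → 0 < B w w)
    (h12 : ∀ u v z w, R u v z w = -R v u z w) (h34 : ∀ u v z w, R u v z w = -R u v w z)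
    (hC : ∀ u y, B u u < 0 → B u y = 0 → |R y u u y| ≤ C * (B y y * -(B u u))) :
    ∃ k : ℝ, ∀ u v, R u v v u = k * (B u u * B v v - B u v ^ 2) := by
  have swap : ∀ u v, R u v v u = R v u u v := fun u v ↦ by rw [h12, h34]; ring
  have hd12 : ∀ u z w, R u u z w = 0 := fun u z w ↦ by linarith [h12 u u z w]
  have hd34 : ∀ u v z, R u v z z = 0 := fun u v z ↦ by linarith [h34 u v z z]
  have null : ∀ {x y : V}, B e x = 0 → B e y = 0 → B x y = 0 →
      R y e x y + R y x e y = 0 ∧ R y x x y = - (B x x * R y e e y) := by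
    intro x y hx hy hxy
    by_cases h0 : x = 0
    · simp [h0]
    · exact curvatureForm_of_timelike_bound hB he hC hx (hpos x hx h0) hy hxy
  have prop : ∀ {x y : V}, B e x = 0 → B e y = 0 → B x y = 0 →
      B x x * R y e e y = B y y * R x e e x := by
    intro x y hx hy hxy
    have h1 := (null hx hy hxy).2
    have h2 := (null hy hx (by rw [hB, hxy])).2
    rw [swap] at h1
    linarith
  -- the Jacobi form of `e` is a multiple of the metric on the orthogonal complement of `e`
  obtain ⟨k, hk⟩ : ∃ k : ℝ, ∀ x, B e x = 0 → R x e e x = -k * B x x := by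
    by_cases hex : ∃ x, B e x = 0 ∧ x ≠ 0
    swap
    · push Not at hex
      exact ⟨0, fun x hx ↦ by simp [hex x hx]⟩
    obtain ⟨x, hx, hx0⟩ := hex
    have hα := hpos x hx hx0
    obtain ⟨κ, hκ⟩ : ∃ κ, R x e e x = κ * B x x := ⟨R x e e x / B x x, by field_simp⟩
    have horth : ∀ z, B e z = 0 → B x z = 0 → R z e e z = κ * B z z := by
      intro z hz hxz
      have h := prop hx hz hxz
      rw [hκ] at h
      apply mul_left_cancel₀ hα.ne'
      rw [h]; ring
    have hpolar : ∀ z, B e z = 0 → B x z = 0 → R x e e z + R z e e x = 0 := by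
      intro z hz hxz
      by_cases hz0 : z = 0
      · simp [hz0]
      have hβ := hpos z hz hz0
      have hzx : B z x = 0 := by rw [hB, hxz]
      -- These two combinations are orthogonal to each other. Proportionality on `x` and on `z` is
      -- already known, so all that remains of `prop` is a positive multiple of the cross term.
      have h := prop (x := B z z • x + B x x • z) (y := x + (-1 : ℝ) • z) (by simp [hx, hz])
        (by simp [hx, hz]) (by
          simp only [map_add, map_smul, add_apply, smul_apply,
            smul_eq_mul, hxz, hzx]; ring)
      simp only [map_add, map_smul, add_apply, smul_apply,
        smul_eq_mul, hxz, hzx, hκ, horth z hz hxz] at h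
      have h' : (B z z * B x x * (B x x + B z z) * 2) * (R x e e z + R z e e x) = 0 := by
        linear_combination -h
      exact (mul_eq_zero.1 h').resolve_left (by positivity)
    -- The sign comes from `B e e = -1`: the Gram determinant of `e` and `v` is `-B v v`.
    refine ⟨-κ, fun v hv ↦ ?_⟩
    obtain ⟨a, z, hz, hxz, rfl⟩ : ∃ (a : ℝ) (z : V), B e z = 0 ∧ B x z = 0 ∧ v = a • x + z := by
      refine ⟨B x v / B x x, v - (B x v / B x x) • x, by simp [hx, hv], ?_, by abel⟩
      simp only [map_sub, map_smul, smul_eq_mul]; field_simp; ring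
    have hzx : B z x = 0 := by rw [hB, hxz]
    simp only [map_add, map_smul, add_apply, smul_apply, smul_eq_mul, hxz,
      hzx, hκ, horth z hz hxz]
    linear_combination a * hpolar z hz hxz
  -- planes meeting the orthogonal complement of `e`
  have key : ∀ u y, B e y = 0 → R u y y u = k * (B u u * B y y - B u y ^ 2) := by
    intro u y hy
    by_cases hy0 : y = 0
    · simp [hy0]
    have hβ := hpos y hy hy0
    -- Orthogonal decomposition of `u`. The component along `y` does not contribute, and `null`
    -- applied to `z` and `y` removes the terms mixing `e` with `z`.
    obtain ⟨a, c, z, hz, hyz, rfl⟩ : ∃ (a c : ℝ) (z : V), B e z = 0 ∧ B z y = 0 ∧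
        u = a • e + c • y + z := by
      refine ⟨-B e u, B u y / B y y, u + B e u • e - (B u y / B y y) • y, ?_, ?_, by module⟩
      · simp [hy, he]
      · simp only [map_sub, map_add, map_smul, smul_eq_mul, sub_apply,
          add_apply, smul_apply, hy]
        field_simp; ring
    have hye : B y e = 0 := by rw [hB, hy]
    have hze : B z e = 0 := by rw [hB, hz]
    have hzy : B y z = 0 := by rw [hB, hyz]
    obtain ⟨h1, h2⟩ := null hz hy hyz
    rw [swap]
    simp only [map_add, map_smul, smul_eq_mul, add_apply, smul_apply, hd12,
      hd34, hy, hye, hz, hze, hyz, hzy, he]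
    rw [h2, hk y hy]
    linear_combination a * h1
  refine ⟨k, fun u v ↦ ?_⟩
  by_cases hv : B e v = 0
  · exact key u v hv
  -- Every plane meets the hyperplane orthogonal to `e`, and adding a multiple of `v` to `u` changes
  -- neither the Gram determinant nor `R v u u v`.
  have h := key v (u + (-(B e u / B e v)) • v) (by
    simp only [map_add, map_smul, smul_eq_mul]; field_simp; ring)
  rw [swap] at h
  simp only [map_add, map_smul, smul_eq_mul, add_apply, smul_apply, hd12,
    hd34, hB v u] at h
  linear_combination h

/-- On a finite-dimensional subspace where `B` is positive definite, every quadratic form is bounded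
by a multiple of `B`. -/
theorem exists_quadratic_le_mul_of_pos_orthogonal [FiniteDimensional ℝ V]
    (Q : V →L[ℝ] V →L[ℝ] ℝ)
    (hpos : ∀ w, B e w = 0 → w ≠ 0 → 0 < B w w) :
    ∃ C, ∀ y, B e y = 0 → |Q y y| ≤ C * B y y := by
  have hK : IsCompact (Metric.sphere (0 : V) 1 ∩ {y | B e y = 0}) :=
    (isCompact_sphere 0 1).inter_right (isClosed_eq (by fun_prop) (by fun_prop))
  have hKpos : ∀ y ∈ Metric.sphere (0 : V) 1 ∩ {y | B e y = 0}, 0 < B y y := by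
    rintro y ⟨hy1, hy⟩
    exact hpos y hy (ne_zero_of_mem_unit_sphere ⟨y, hy1⟩)
  -- The quotient is homogeneous of degree 0, so a bound on the compact unit sphere is a bound
  -- everywhere.
  obtain ⟨C, hC⟩ := hK.exists_bound_of_continuousOn (f := fun y ↦ Q y y / B y y)
    (ContinuousOn.div (by fun_prop) (by fun_prop) fun y hy ↦ (hKpos y hy).ne')
  refine ⟨C, fun y hy ↦ ?_⟩
  by_cases hy0 : y = 0
  · simp [hy0]
  have hn : ‖y‖ ≠ 0 := norm_ne_zero_iff.2 hy0
  have h := hC (‖y‖⁻¹ • y) ⟨by simp [norm_smul, hn], by simp [hy]⟩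
  simp only [map_smul, smul_apply, smul_eq_mul] at h
  rw [mul_div_mul_left _ _ (inv_ne_zero hn), mul_div_mul_left _ _ (inv_ne_zero hn), norm_div,
    Real.norm_eq_abs, Real.norm_eq_abs, abs_of_pos (hpos y hy hy0),
    div_le_iff₀ (hpos y hy hy0)] at h
  exact h

end CurvatureAlgebra

noncomputable section

/-! ### The Levi-Civita connection and its curvature in linear coordinates -/

namespace CoordMetric

variable {E : Type*} [NormedAddCommGroup E] [NormedSpace ℝ E]

/-- The Christoffel symbols of the first kind as a bundled bilinear map. -/
def christoffelFirstL (G : E → E →L[ℝ] E →L[ℝ] ℝ) (y : E) : E →L[ℝ] E →L[ℝ] E →L[ℝ] ℝ :=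
  (1 / 2 : ℝ) • (fderiv ℝ G y +
    ContinuousLinearMap.flipₗᵢ ℝ E E (E →L[ℝ] ℝ) (fderiv ℝ G y) -
    ((ContinuousLinearMap.flipₗᵢ ℝ E E ℝ).toContinuousLinearEquiv :
      (E →L[ℝ] E →L[ℝ] ℝ) →L[ℝ] (E →L[ℝ] E →L[ℝ] ℝ)) ∘L
        ContinuousLinearMap.flipₗᵢ ℝ E E (E →L[ℝ] ℝ) (fderiv ℝ G y))

theorem christoffelFirst_apply (G : E → E →L[ℝ] E →L[ℝ] ℝ) (y u v w : E) :
    christoffelFirst G y u v w =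
      (fderiv ℝ G y u v w + fderiv ℝ G y v u w - fderiv ℝ G y w u v) / 2 := by
  simp [christoffelFirst]; ring

/-- The Christoffel symbols of the second kind as a bundled bilinear map. -/
def christoffelL (G : E → E →L[ℝ] E →L[ℝ] ℝ) (y : E) : E →L[ℝ] E →L[ℝ] E :=
  (ContinuousLinearMap.compL ℝ E (E →L[ℝ] ℝ) E (G y).inverse) ∘L christoffelFirstL G y

theorem christoffelL_apply (G : E → E →L[ℝ] E →L[ℝ] ℝ) (y u v : E) :
    christoffelL G y u v = christoffel G y u v := rfl

/-- A `C²` family of symmetric bilinear forms, nondegenerate at `y`. -/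
structure IsRegularAt (G : E → E →L[ℝ] E →L[ℝ] ℝ) (y : E) : Prop where
  contDiffAt : ContDiffAt ℝ 2 G y
  symm : ∀ᶠ y' in 𝓝 y, ∀ u v, G y' u v = G y' v u
  isInvertible : (G y).IsInvertible

variable {G H : E → E →L[ℝ] E →L[ℝ] ℝ} {y : E}

theorem apply_christoffel (h : (G y).IsInvertible) (u v w : E) :
    G y (christoffel G y u v) w = christoffelFirst G y u v w := by
  obtain ⟨e, he⟩ := h
  simp only [christoffel, ← he, ContinuousLinearMap.inverse_equiv]
  simp

theorem fderiv_apply₂ (h : DifferentiableAt ℝ G y) (u v w : E) :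
    fderiv ℝ (fun y' ↦ G y' v w) y u = fderiv ℝ G y u v w := by
  have h1 : HasFDerivAt G (fderiv ℝ G y) y := h.hasFDerivAt
  have h2 := (h1.clm_apply (hasFDerivAt_const v y)).clm_apply (hasFDerivAt_const w y)
  rw [h2.fderiv]
  simp

namespace IsRegularAt

theorem eventually_differentiableAt (h : IsRegularAt G y) :
    ∀ᶠ y' in 𝓝 y, DifferentiableAt ℝ G y' := by
  filter_upwards [h.contDiffAt.eventually (by simp)] with y' hy'
  exact hy'.differentiableAt (by simp)

theorem fderiv_symm (h : IsRegularAt G y) (u v w : E) :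
    fderiv ℝ G y u v w = fderiv ℝ G y u w v := by
  have hd := h.eventually_differentiableAt.self_of_nhds
  rw [← fderiv_apply₂ hd, ← fderiv_apply₂ hd]
  congr 1
  apply Filter.EventuallyEq.fderiv_eq
  filter_upwards [h.symm] with y' hy' using hy' v w

/-- The Levi-Civita connection is metric. -/
theorem fderiv_apply (h : IsRegularAt G y) (u v w : E) :
    fderiv ℝ G y u v w = G y (christoffel G y u v) w + G y v (christoffel G y u w) := by
  rw [h.symm.self_of_nhds v, apply_christoffel h.isInvertible, apply_christoffel h.isInvertible,
    christoffelFirst_apply, christoffelFirst_apply, h.fderiv_symm u w v, h.fderiv_symm v u w,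
    h.fderiv_symm w u v]
  ring

variable [CompleteSpace E]

theorem eventually_isInvertible (h : IsRegularAt G y) : ∀ᶠ y' in 𝓝 y, (G y').IsInvertible := by
  obtain ⟨e, he⟩ := h.isInvertible
  have h1 := h.contDiffAt.continuousAt.preimage_mem_nhds (he ▸ e.nhds)
  filter_upwards [h1] with y' hy' using hy'

theorem eventually (h : IsRegularAt G y) : ∀ᶠ y' in 𝓝 y, IsRegularAt G y' := by
  filter_upwards [h.contDiffAt.eventually (by simp), h.symm.eventually_nhds,
    h.eventually_isInvertible] with y' h1 h2 h3 using ⟨h1, h2, h3⟩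

theorem contDiffAt_christoffelL (h : IsRegularAt G y) : ContDiffAt ℝ 1 (christoffelL G) y := by
  have h1 : ContDiffAt ℝ 1 (fderiv ℝ G) y := h.contDiffAt.fderiv_right (by norm_num)
  have h2 : ContDiffAt ℝ 1 (fun y ↦ (G y).inverse) y :=
    ContDiffAt.comp y (h.isInvertible.contDiffAt_map_inverse) (h.contDiffAt.of_le (by norm_num))
  have h3 : ContDiffAt ℝ 1 (fun y ↦ ContinuousLinearMap.flipₗᵢ ℝ E E (E →L[ℝ] ℝ)
      (fderiv ℝ G y)) y :=
    (ContinuousLinearMap.flipₗᵢ ℝ E E (E →L[ℝ] ℝ)).toContinuousLinearEquiv.contDiff.contDiffAt.comp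
      y h1
  have h4 : ContDiffAt ℝ 1 (christoffelFirstL G) y :=
    ((h1.add h3).sub (contDiffAt_const.clm_comp h3)).const_smul (1 / 2 : ℝ)
  exact ((ContinuousLinearMap.compL ℝ E (E →L[ℝ] ℝ) E).contDiff.contDiffAt.comp y h2).clm_comp h4

theorem differentiableAt_christoffelL (h : IsRegularAt G y) :
    DifferentiableAt ℝ (christoffelL G) y :=
  h.contDiffAt_christoffelL.differentiableAt (by simp)

theorem curvature_eq (h : IsRegularAt G y) (u v z : E) :
    curvature G y u v z =
      (fderiv ℝ (christoffelL G) y u v z + christoffel G y u (christoffel G y v z)) -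
      (fderiv ℝ (christoffelL G) y v u z + christoffel G y v (christoffel G y u z)) := by
  have key : ∀ u v, fderiv ℝ (fun y' ↦ christoffel G y' v z) y u =
      fderiv ℝ (christoffelL G) y u v z := fun u v ↦ by
    have h2 := (h.differentiableAt_christoffelL.hasFDerivAt.clm_apply
      (hasFDerivAt_const v y)).clm_apply (hasFDerivAt_const z y)
    simp only [christoffelL_apply] at h2
    rw [h2.fderiv]
    simp
  simp only [curvature, key]

/-- Second derivatives of `G(z, z)` commute. Computing them by metric compatibility and
antisymmetrizing in `u, v` leaves `2 G(R(u,v)z, z)`, because the terms `G(Γ(u,z), Γ(v,z))` cancel.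
-/
theorem apply_curvature_self (h : IsRegularAt G y) (u v z : E) :
    G y (curvature G y u v z) z = 0 := by
  have hφ : ContDiffAt ℝ 2 (fun y' ↦ G y' z z) y :=
    (h.contDiffAt.clm_apply contDiffAt_const).clm_apply contDiffAt_const
  have hsymm := hφ.isSymmSndFDerivAt (by simp)
  have hdiff : DifferentiableAt ℝ (fderiv ℝ (fun y' ↦ G y' z z)) y :=
    (hφ.fderiv_right (m := 1) (by norm_num)).differentiableAt (by simp)
  have key : ∀ u v, fderiv ℝ (fderiv ℝ (fun y' ↦ G y' z z)) y u v =
      2 * (fderiv ℝ G y u (christoffel G y v z) z +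
        G y (fderiv ℝ (christoffelL G) y u v z) z) := by
    intro u v
    have h1 : fderiv ℝ (fderiv ℝ (fun y' ↦ G y' z z)) y u v =
        fderiv ℝ (fun y' ↦ fderiv ℝ (fun y' ↦ G y' z z) y' v) y u := by
      rw [(hdiff.hasFDerivAt.clm_apply (hasFDerivAt_const v y)).fderiv]
      simp
    have h2 : (fun y' ↦ fderiv ℝ (fun y' ↦ G y' z z) y' v) =ᶠ[𝓝 y]
        fun y' ↦ 2 * G y' (christoffelL G y' v z) z := by
      filter_upwards [h.eventually] with y' hy'
      rw [fderiv_apply₂ hy'.eventually_differentiableAt.self_of_nhds, christoffelL_apply,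
        hy'.fderiv_apply, hy'.symm.self_of_nhds z]
      ring
    have h3 := ((h.eventually_differentiableAt.self_of_nhds.hasFDerivAt.clm_apply
      ((h.differentiableAt_christoffelL.hasFDerivAt.clm_apply
      (hasFDerivAt_const v y)).clm_apply (hasFDerivAt_const z y))).clm_apply
      (hasFDerivAt_const z y)).const_mul (2 : ℝ)
    rw [h1, h2.fderiv_eq, h3.fderiv]
    simp [christoffelL_apply]
    ring
  have h1 := hsymm u v
  rw [key, key, h.fderiv_apply, h.fderiv_apply] at h1
  have h2 := h.symm.self_of_nhds (christoffel G y v z) (christoffel G y u z)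
  rw [h.curvature_eq]
  simp only [map_sub, map_add, sub_apply, add_apply]
  linarith

end IsRegularAt

/-! ### Naturality under local diffeomorphisms -/

section Pullback

variable {F : E → E}

theorem fderiv_pullback (hG : DifferentiableAt ℝ G y) (hH : DifferentiableAt ℝ H (F y))
    (hF : ContDiffAt ℝ 2 F y)
    (hGH : ∀ᶠ y' in 𝓝 y, ∀ v w, G y' v w = H (F y') (fderiv ℝ F y' v) (fderiv ℝ F y' w))
    (u v w : E) :
    fderiv ℝ G y u v w =
      fderiv ℝ H (F y) (fderiv ℝ F y u) (fderiv ℝ F y v) (fderiv ℝ F y w) +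
      H (F y) (fderiv ℝ (fderiv ℝ F) y u v) (fderiv ℝ F y w) +
      H (F y) (fderiv ℝ F y v) (fderiv ℝ (fderiv ℝ F) y u w) := by
  have h1 : (fun y' ↦ G y' v w) =ᶠ[𝓝 y]
      fun y' ↦ H (F y') (fderiv ℝ F y' v) (fderiv ℝ F y' w) := by
    filter_upwards [hGH] with y' hy' using hy' v w
  have hF1 : HasFDerivAt F (fderiv ℝ F y) y := (hF.differentiableAt (by simp)).hasFDerivAt
  have hF2 : HasFDerivAt (fderiv ℝ F) (fderiv ℝ (fderiv ℝ F) y) y :=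
    ((hF.fderiv_right (m := 1) (by norm_num)).differentiableAt (by simp)).hasFDerivAt
  have h2 := ((hH.hasFDerivAt.comp y hF1).clm_apply
    (hF2.clm_apply (hasFDerivAt_const v y))).clm_apply (hF2.clm_apply (hasFDerivAt_const w y))
  simp only [Function.comp_apply] at h2
  rw [← fderiv_apply₂ hG, h1.fderiv_eq, h2.fderiv]
  simp
  ring

variable [FiniteDimensional ℝ E]

/-- The three derivatives in the Christoffel symbol each produce two terms in `D²F`. As `D²F` and
`H` are symmetric, these cancel down to `H(D²F(u,v), DF w)`, the inhomogeneous term of the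
transformation law. -/
theorem fderiv_christoffel_pullback (hG : IsRegularAt G y) (hH : IsRegularAt H (F y))
    (hF : ContDiffAt ℝ 2 F y)
    (hGH : ∀ᶠ y' in 𝓝 y, ∀ v w, G y' v w = H (F y') (fderiv ℝ F y' v) (fderiv ℝ F y' w))
    (u v : E) :
    fderiv ℝ F y (christoffel G y u v) =
      christoffel H (F y) (fderiv ℝ F y u) (fderiv ℝ F y v) + fderiv ℝ (fderiv ℝ F) y u v := by
  have hGy := hGH.self_of_nhds
  -- The kernel of `DF` lies in the radical of `G`, which is zero. In finite dimension `DF` is then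
  -- onto, so vectors `DF w` suffice as test vectors.
  have hinj : Function.Injective (fderiv ℝ F y : E →ₗ[ℝ] E) := by
    rw [injective_iff_map_eq_zero]
    intro a ha
    obtain ⟨e, he⟩ := hG.isInvertible
    apply e.injective
    rw [map_zero]
    ext w
    have h1 : e a = G y a := by rw [← he]; rfl
    have h2 : fderiv ℝ F y a = 0 := ha
    rw [h1, hGy, h2]
    simp
  have hsurj := LinearMap.injective_iff_surjective.1 hinj
  obtain ⟨e, he⟩ := hH.isInvertible
  apply e.injective
  ext w'
  obtain ⟨w, rfl⟩ := hsurj w'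
  have h1 : ∀ a, e a = H (F y) a := fun a ↦ by rw [← he]; rfl
  have hd := fderiv_pullback hG.eventually_differentiableAt.self_of_nhds
    hH.eventually_differentiableAt.self_of_nhds hF hGH
  have hS : ∀ a b, fderiv ℝ (fderiv ℝ F) y a b = fderiv ℝ (fderiv ℝ F) y b a :=
    fun a b ↦ hF.isSymmSndFDerivAt (by simp) a b
  have hs := hH.symm.self_of_nhds
  simp only [h1, map_add, add_apply, ContinuousLinearMap.coe_coe]
  rw [← hGy, apply_christoffel hG.isInvertible, apply_christoffel hH.isInvertible,
    christoffelFirst_apply, christoffelFirst_apply, hd, hd, hd, hS v u, hS w u, hS w v,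
    hs (fderiv ℝ F y u), hs (fderiv ℝ F y v)]
  ring

/-- The curvature operator is natural under local isometries. -/
theorem fderiv_curvature_pullback (hG : IsRegularAt G y) (hH : IsRegularAt H (F y))
    (hF : ContDiffAt ℝ 3 F y)
    (hGH : ∀ᶠ y' in 𝓝 y, ∀ v w, G y' v w = H (F y') (fderiv ℝ F y' v) (fderiv ℝ F y' w))
    (u v z : E) :
    fderiv ℝ F y (curvature G y u v z) =
      curvature H (F y) (fderiv ℝ F y u) (fderiv ℝ F y v) (fderiv ℝ F y z) := by
  have hF' : ContDiffAt ℝ 2 F y := hF.of_le (by norm_num)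
  have hF1 : HasFDerivAt F (fderiv ℝ F y) y := (hF.differentiableAt (by simp)).hasFDerivAt
  have hFc : ContDiffAt ℝ 2 (fderiv ℝ F) y := hF.fderiv_right (by norm_num)
  have hF2 : HasFDerivAt (fderiv ℝ F) (fderiv ℝ (fderiv ℝ F) y) y :=
    (hFc.differentiableAt (by simp)).hasFDerivAt
  have hF3 : HasFDerivAt (fderiv ℝ (fderiv ℝ F)) (fderiv ℝ (fderiv ℝ (fderiv ℝ F)) y) y :=
    ((hFc.fderiv_right (m := 1) (by norm_num)).differentiableAt (by simp)).hasFDerivAt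
  -- The transformation law holds on a neighbourhood, so it can be differentiated once more.
  -- Antisymmetrizing the result removes `D³F`, and the remaining `D²F` terms cancel.
  have hΓ : ∀ᶠ y' in 𝓝 y, ∀ v z, fderiv ℝ F y' (christoffelL G y' v z) =
      christoffelL H (F y') (fderiv ℝ F y' v) (fderiv ℝ F y' z) +
        fderiv ℝ (fderiv ℝ F) y' v z := by
    filter_upwards [hG.eventually, hF.continuousAt.eventually hH.eventually,
      hF'.eventually (by simp), hGH.eventually_nhds] with y' h1 h2 h3 h4 v z
    exact fderiv_christoffel_pullback h1 h2 h3 h4 v z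
  have hΓG := hG.differentiableAt_christoffelL.hasFDerivAt
  have hΓH := hH.differentiableAt_christoffelL.hasFDerivAt
  have key : ∀ u v, fderiv ℝ (fderiv ℝ F) y u (christoffel G y v z) +
      fderiv ℝ F y (fderiv ℝ (christoffelL G) y u v z) =
      fderiv ℝ (christoffelL H) (F y) (fderiv ℝ F y u) (fderiv ℝ F y v) (fderiv ℝ F y z) +
      christoffelL H (F y) (fderiv ℝ (fderiv ℝ F) y u v) (fderiv ℝ F y z) +
      christoffelL H (F y) (fderiv ℝ F y v) (fderiv ℝ (fderiv ℝ F) y u z) +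
      fderiv ℝ (fderiv ℝ (fderiv ℝ F)) y u v z := by
    intro u v
    have h1 := hF2.clm_apply ((hΓG.clm_apply (hasFDerivAt_const v y)).clm_apply
      (hasFDerivAt_const z y))
    have h2 := (((hΓH.comp y hF1).clm_apply (hF2.clm_apply (hasFDerivAt_const v y))).clm_apply
      (hF2.clm_apply (hasFDerivAt_const z y))).add
      ((hF3.clm_apply (hasFDerivAt_const v y)).clm_apply (hasFDerivAt_const z y))
    have h3 : (fun y' ↦ fderiv ℝ F y' (christoffelL G y' v z)) =ᶠ[𝓝 y] fun y' ↦
      christoffelL H (F y') (fderiv ℝ F y' v) (fderiv ℝ F y' z) +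
        fderiv ℝ (fderiv ℝ F) y' v z := by
      filter_upwards [hΓ] with y' hy' using hy' v z
    have h4 := congrArg (fun L ↦ L u) (h1.unique (h2.congr_of_eventuallyEq h3))
    simp [christoffelL_apply] at h4
    simp only [christoffelL_apply]
    rw [add_comm, h4]
    abel
  have hS : ∀ a b, fderiv ℝ (fderiv ℝ F) y a b = fderiv ℝ (fderiv ℝ F) y b a :=
    fun a b ↦ hF'.isSymmSndFDerivAt (by simp) a b
  have hT : ∀ a b, fderiv ℝ (fderiv ℝ (fderiv ℝ F)) y a b =
      fderiv ℝ (fderiv ℝ (fderiv ℝ F)) y b a :=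
    fun a b ↦ hFc.isSymmSndFDerivAt (by simp) a b
  have hΓy := hΓ.self_of_nhds
  have key' : ∀ u v, fderiv ℝ F y (fderiv ℝ (christoffelL G) y u v z) = _ :=
    fun u v ↦ eq_sub_of_add_eq' (key u v)
  rw [hG.curvature_eq, hH.curvature_eq]
  simp only [map_sub, map_add, key', ← christoffelL_apply, hΓy]
  rw [hS v u, hT v u]
  abel

end Pullback

end CoordMetric

/-! ### The metric in charts and invariance of its curvature -/

namespace LorentzianMetric

variable {E : Type*} [NormedAddCommGroup E] [NormedSpace ℝ E]
  {M : Type*} [TopologicalSpace M] [ChartedSpace E M] [IsManifold 𝓘(ℝ, E) ∞ M]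
  (g : LorentzianMetric E M)

/-- A vector in the radical is orthogonal to the timelike `e`, hence would have positive square if
nonzero. -/
theorem eq_zero_of_inner_eq_zero {x : M} {v : TangentSpace 𝓘(ℝ, E) x}
    (h : ∀ w, g.inner x v w = 0) : v = 0 := by
  obtain ⟨e, -, hpos⟩ := g.lorentzian x
  by_contra h0
  exact (hpos v (by rw [g.symm, h]) h0).ne' (h v)

theorem hasMFDerivAt_extChartAt_symm {p : M} {y : E}
    (hy : y ∈ (extChartAt 𝓘(ℝ, E) p).target) :
    HasMFDerivAt 𝓘(ℝ, E) 𝓘(ℝ, E) (extChartAt 𝓘(ℝ, E) p).symm y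
      (mfderiv 𝓘(ℝ, E) 𝓘(ℝ, E) (extChartAt 𝓘(ℝ, E) p).symm y) := by
  have : IsManifold 𝓘(ℝ, E) 1 M := IsManifold.of_le (n := ∞) (by simp)
  have h := mdifferentiableWithinAt_extChartAt_symm (I := 𝓘(ℝ, E)) hy
  rw [modelWithCornersSelf_coe, Set.range_id, mdifferentiableWithinAt_univ] at h
  exact h.hasMFDerivAt

theorem mfderiv_extChartAt_symm_apply_mfderiv {p x : M}
    (hx : x ∈ (extChartAt 𝓘(ℝ, E) p).source) (a : TangentSpace 𝓘(ℝ, E) x) :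
    (mfderiv 𝓘(ℝ, E) 𝓘(ℝ, E) (extChartAt 𝓘(ℝ, E) p).symm (extChartAt 𝓘(ℝ, E) p x)
      (mfderiv 𝓘(ℝ, E) 𝓘(ℝ, E) (extChartAt 𝓘(ℝ, E) p) x a) : E) = a := by
  have : IsManifold 𝓘(ℝ, E) 1 M := IsManifold.of_le (n := ∞) (by simp)
  have h := mfderivWithin_extChartAt_symm_comp_mfderiv_extChartAt' (I := 𝓘(ℝ, E)) hx
  rw [modelWithCornersSelf_coe, Set.range_id, mfderivWithin_univ] at h
  exact congrArg (fun L : E →L[ℝ] E ↦ L a) h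

theorem inChart_apply_mfderiv {p x : M} (hx : x ∈ (extChartAt 𝓘(ℝ, E) p).source)
    (a b : TangentSpace 𝓘(ℝ, E) x) :
    g.inChart p (extChartAt 𝓘(ℝ, E) p x) (mfderiv 𝓘(ℝ, E) 𝓘(ℝ, E) (extChartAt 𝓘(ℝ, E) p) x a)
      (mfderiv 𝓘(ℝ, E) 𝓘(ℝ, E) (extChartAt 𝓘(ℝ, E) p) x b) = g.inner x a b := by
  -- Generalizing the base point avoids a transport between the tangent spaces at `φ.symm (φ x)` and
  -- `x`.
  have h : ∀ (x' : M) (a' b' : E), x' = x → a' = a → b' = b →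
      (g.inner x' : E →L[ℝ] E →L[ℝ] ℝ) a' b' = g.inner x a b := by
    rintro _ _ _ rfl rfl rfl; rfl
  exact h _ _ _ ((extChartAt 𝓘(ℝ, E) p).left_inv hx)
    (mfderiv_extChartAt_symm_apply_mfderiv hx a) (mfderiv_extChartAt_symm_apply_mfderiv hx b)

/-- The derivative of the chart at its own centre is the identity, since the tangent space is
modelled on `E` through that preferred chart. -/
theorem riemann_eq (p : M) (u v z w : TangentSpace 𝓘(ℝ, E) p) :
    g.riemann p u v z w = g.inChart p (extChartAt 𝓘(ℝ, E) p p)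
      (CoordMetric.curvature (g.inChart p) (extChartAt 𝓘(ℝ, E) p p) u v z) w := by
  have : IsManifold 𝓘(ℝ, E) 1 M := IsManifold.of_le (n := ∞) (by simp)
  simp only [riemann]
  rw [mfderiv_extChartAt_self]
  rfl

theorem inChart_symm (p : M) (y u v : E) : g.inChart p y u v = g.inChart p y v u :=
  g.symm ((extChartAt 𝓘(ℝ, E) p).symm y)
    (mfderiv 𝓘(ℝ, E) 𝓘(ℝ, E) (extChartAt 𝓘(ℝ, E) p).symm y u)
    (mfderiv 𝓘(ℝ, E) 𝓘(ℝ, E) (extChartAt 𝓘(ℝ, E) p).symm y v)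

/-- The derivative of the inverse chart applied to a constant vector is a local frame field of the
tangent bundle trivialization; the metric evaluated on two smooth sections is smooth. -/
theorem contDiffAt_inChart_apply {p : M} {y : E} (hy : y ∈ (extChartAt 𝓘(ℝ, E) p).target)
    (u v : E) : ContDiffAt ℝ ∞ (fun y ↦ g.inChart p y u v) y := by
  have : IsManifold 𝓘(ℝ, E) 1 M := IsManifold.of_le (n := ∞) (by simp)
  set e := trivializationAt E (TangentSpace 𝓘(ℝ, E)) p with he
  have hsec : ∀ u : E, ContMDiffOn 𝓘(ℝ, E) (𝓘(ℝ, E).prod 𝓘(ℝ, E)) ∞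
      (fun x ↦ Bundle.TotalSpace.mk' E x (e.symmL ℝ x u)) e.baseSet := by
    intro u
    rw [e.contMDiffOn_section_baseSet_iff]
    refine (contMDiffOn_const (c := u)).congr fun x hx ↦ ?_
    have := e.continuousLinearMapAt_symmL (R := ℝ) hx u
    rw [e.continuousLinearMapAt_apply_of_mem ℝ hx] at this
    exact this
  have hbase : e.baseSet = (extChartAt 𝓘(ℝ, E) p).source := by simp [he]
  have hx : (extChartAt 𝓘(ℝ, E) p).symm y ∈ e.baseSet := by
    rw [hbase]; exact (extChartAt 𝓘(ℝ, E) p).map_target hy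
  have hat : ∀ u : E, ContMDiffAt 𝓘(ℝ, E) (𝓘(ℝ, E).prod 𝓘(ℝ, E)) ∞
      (fun x ↦ Bundle.TotalSpace.mk' E x (e.symmL ℝ x u)) ((extChartAt 𝓘(ℝ, E) p).symm y) :=
    fun u ↦ (hsec u).contMDiffAt (e.open_baseSet.mem_nhds hx)
  have hin : ContMDiffAt 𝓘(ℝ, E) (𝓘(ℝ, E).prod 𝓘(ℝ)) ∞
      (fun x ↦ Bundle.TotalSpace.mk' ℝ (E := Bundle.Trivial M ℝ) x
        (g.inner x (e.symmL ℝ x u) (e.symmL ℝ x v))) ((extChartAt 𝓘(ℝ, E) p).symm y) :=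
    ContMDiffAt.clm_bundle_apply₂ (F₁ := E) (F₂ := E) g.contMDiff.contMDiffAt (hat u) (hat v)
  simp only [Bundle.contMDiffAt_totalSpace] at hin
  have htgt : (extChartAt 𝓘(ℝ, E) p).target ∈ 𝓝 y := (isOpen_extChartAt_target p).mem_nhds hy
  have hcomp := ContMDiffAt.comp y hin.2
    ((contMDiffOn_extChartAt_symm (n := ∞) p).contMDiffAt htgt)
  refine ContDiffAt.congr_of_eventuallyEq hcomp.contDiffAt ?_
  filter_upwards [htgt] with y' hy'
  have hx' := (extChartAt 𝓘(ℝ, E) p).map_target hy'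
  rw [extChartAt_source] at hx'
  have h := TangentBundle.symmL_trivializationAt (I := 𝓘(ℝ, E)) (𝕜 := ℝ) hx'
  rw [(extChartAt 𝓘(ℝ, E) p).right_inv hy', modelWithCornersSelf_coe, Set.range_id,
    mfderivWithin_univ] at h
  have key : ∀ w : E, e.symmL ℝ ((extChartAt 𝓘(ℝ, E) p).symm y') w =
      mfderiv 𝓘(ℝ, E) 𝓘(ℝ, E) (extChartAt 𝓘(ℝ, E) p).symm y' w :=
    fun w ↦ congrArg (fun L : E →L[ℝ] E ↦ L w) h
  exact congrArg₂ (fun a b ↦ g.inner ((extChartAt 𝓘(ℝ, E) p).symm y') a b)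
    (key u).symm (key v).symm

variable [FiniteDimensional ℝ E]

theorem isRegularAt_inChart {p : M} {y : E} (hy : y ∈ (extChartAt 𝓘(ℝ, E) p).target) :
    CoordMetric.IsRegularAt (g.inChart p) y where
  contDiffAt := by
    have h : ContDiffOn ℝ ∞ (g.inChart p) (extChartAt 𝓘(ℝ, E) p).target :=
      contDiffOn_clm_apply.2 fun u ↦ contDiffOn_clm_apply.2 fun v _ hy' ↦
        (g.contDiffAt_inChart_apply hy' u v).contDiffWithinAt
    exact (h.contDiffAt ((isOpen_extChartAt_target p).mem_nhds hy)).of_le (by norm_cast)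
  symm := .of_forall fun y' u v ↦ g.inChart_symm p y' u v
  isInvertible := by
    have hx := (extChartAt 𝓘(ℝ, E) p).map_target hy
    have : IsManifold 𝓘(ℝ, E) 1 M := IsManifold.of_le (n := ∞) (by simp)
    have hinj : Function.Injective (g.inChart p y : E →ₗ[ℝ] E →L[ℝ] ℝ) := by
      rw [injective_iff_map_eq_zero]
      intro a ha
      obtain ⟨L, hL⟩ := isInvertible_mfderiv_extChartAt (I := 𝓘(ℝ, E)) hx
      have h := g.inChart_apply_mfderiv hx
      rw [(extChartAt 𝓘(ℝ, E) p).right_inv hy] at h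
      obtain ⟨b, rfl⟩ := L.surjective a
      have hb : b = 0 := by
        refine g.eq_zero_of_inner_eq_zero fun w ↦ ?_
        rw [← h, ← hL]
        exact congrArg (fun l : E →L[ℝ] ℝ ↦ l (L w)) ha
      rw [hb]; exact map_zero L
    have hdim : Module.finrank ℝ E = Module.finrank ℝ (E →L[ℝ] ℝ) := by
      rw [← (LinearMap.toContinuousLinearMap (𝕜 := ℝ) (E := E) (F' := ℝ)).finrank_eq]
      exact (Subspace.dual_finrank_eq (K := ℝ) (V := E)).symm
    exact ⟨(LinearEquiv.ofInjectiveOfFinrankEq (g.inChart p y : E →ₗ[ℝ] E →L[ℝ] ℝ) hinj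
      hdim).toContinuousLinearEquiv, by ext; rfl⟩

theorem isRegularAt_inChart_self (p : M) :
    CoordMetric.IsRegularAt (g.inChart p) (extChartAt 𝓘(ℝ, E) p p) :=
  g.isRegularAt_inChart (mem_extChartAt_target p)

variable {g}

/-- Local isometries preserve the curvature tensor. -/
theorem IsLocalIsometry.riemann_map {f : OpenPartialHomeomorph M M} (hf : g.IsLocalIsometry f)
    {p : M} (hp : p ∈ f.source) (u v z w : TangentSpace 𝓘(ℝ, E) p) :
    g.riemann (f p) (mfderiv 𝓘(ℝ, E) 𝓘(ℝ, E) f p u) (mfderiv 𝓘(ℝ, E) 𝓘(ℝ, E) f p v)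
      (mfderiv 𝓘(ℝ, E) 𝓘(ℝ, E) f p z) (mfderiv 𝓘(ℝ, E) 𝓘(ℝ, E) f p w) =
      g.riemann p u v z w := by
  have : IsManifold 𝓘(ℝ, E) 1 M := IsManifold.of_le (n := ∞) (by simp)
  set φ := extChartAt 𝓘(ℝ, E) p with hφ
  set ψ := extChartAt 𝓘(ℝ, E) (f p) with hψ
  set F : E → E := ψ ∘ f ∘ φ.symm with hF
  have hfx : ∀ x ∈ f.source, ContMDiffAt 𝓘(ℝ, E) 𝓘(ℝ, E) ∞ f x := fun x hx ↦
    hf.contMDiffOn.contMDiffAt (f.open_source.mem_nhds hx)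
  have hφp : φ.symm (φ p) = p := extChartAt_to_inv p
  have htgt : φ.target ∈ 𝓝 (φ p) := extChartAt_target_mem_nhds p
  have hFp : F (φ p) = ψ (f p) := by simp [hF, hφp]
  have hsmooth : ContDiffAt ℝ ∞ F (φ p) := by
    rw [← contMDiffAt_iff_contDiffAt]
    have h1 : ContMDiffAt 𝓘(ℝ, E) 𝓘(ℝ, E) ∞ φ.symm (φ p) :=
      (contMDiffOn_extChartAt_symm p).contMDiffAt htgt
    have h2 : ContMDiffAt 𝓘(ℝ, E) 𝓘(ℝ, E) ∞ f (φ.symm (φ p)) := by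
      rw [hφp]; exact hfx p hp
    have h3 : ContMDiffAt 𝓘(ℝ, E) 𝓘(ℝ, E) ∞ ψ ((f ∘ φ.symm) (φ p)) := by
      rw [Function.comp_apply, hφp]
      exact contMDiffAt_extChartAt (I := 𝓘(ℝ, E))
    exact ContMDiffAt.comp _ h3 (ContMDiffAt.comp _ h2 h1)
  have hnear : ∀ᶠ y in 𝓝 (φ p), y ∈ φ.target ∧ φ.symm y ∈ f.source ∧
      f (φ.symm y) ∈ ψ.source := by
    have hc : ContinuousAt φ.symm (φ p) := continuousAt_extChartAt_symm p
    have h1 : ∀ᶠ x in 𝓝 (φ.symm (φ p)), x ∈ f.source ∧ f x ∈ ψ.source := by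
      rw [hφp]
      exact (f.open_source.eventually_mem hp).and
        ((f.continuousAt hp).eventually (extChartAt_source_mem_nhds (I := 𝓘(ℝ, E)) (f p)))
    exact Filter.Eventually.and htgt (hc.eventually h1)
  have hderiv : ∀ y, y ∈ φ.target → φ.symm y ∈ f.source → f (φ.symm y) ∈ ψ.source → ∀ a : E,
      fderiv ℝ F y a = mfderiv 𝓘(ℝ, E) 𝓘(ℝ, E) ψ (f (φ.symm y))
        (mfderiv 𝓘(ℝ, E) 𝓘(ℝ, E) f (φ.symm y) (mfderiv 𝓘(ℝ, E) 𝓘(ℝ, E) φ.symm y a)) := by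
    intro y h1 h2 h3 a
    have d1 := hasMFDerivAt_extChartAt_symm h1
    have d2 := ((hfx _ h2).mdifferentiableAt (by simp)).hasMFDerivAt
    have d3 := (mdifferentiableAt_extChartAt (I := 𝓘(ℝ, E))
      (by rwa [hψ, extChartAt_source] at h3)).hasMFDerivAt
    have d := hasMFDerivAt_iff_hasFDerivAt.1 (HasMFDerivAt.comp y d3 (HasMFDerivAt.comp y d2 d1))
    exact congrArg (fun L : E →L[ℝ] E ↦ L a) (HasFDerivAt.fderiv d)
  have hpull : ∀ᶠ y in 𝓝 (φ p), ∀ a b, g.inChart p y a b =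
      g.inChart (f p) (F y) (fderiv ℝ F y a) (fderiv ℝ F y b) := by
    filter_upwards [hnear] with y ⟨h1, h2, h3⟩ a b
    rw [hderiv y h1 h2 h3, hderiv y h1 h2 h3]
    refine Eq.trans ?_ (g.inChart_apply_mfderiv h3 _ _).symm
    exact (hf.inner_map _ h2 _ _).symm
  -- At `φ p` both charts are differentiated at their own centres, so they contribute identities and
  -- `DF` is the differential of `f`.
  have hDF : ∀ a : E, fderiv ℝ F (φ p) a = mfderiv 𝓘(ℝ, E) 𝓘(ℝ, E) f p a := by
    intro a
    have d1 : HasMFDerivAt 𝓘(ℝ, E) 𝓘(ℝ, E) φ.symm (φ p) (ContinuousLinearMap.id ℝ E) := by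
      have h := hasMFDerivAt_extChartAt_symm (mem_extChartAt_target (I := 𝓘(ℝ, E)) p)
      have h' := mfderivWithin_range_extChartAt_symm (I := 𝓘(ℝ, E)) (x := p)
      rw [modelWithCornersSelf_coe, Set.range_id, mfderivWithin_univ] at h'
      rw [h'] at h
      exact h
    have d2 : HasMFDerivAt 𝓘(ℝ, E) 𝓘(ℝ, E) f (φ.symm (φ p)) (mfderiv 𝓘(ℝ, E) 𝓘(ℝ, E) f p) := by
      rw [hφp]
      exact ((hfx _ hp).mdifferentiableAt (by simp)).hasMFDerivAt
    have d3 : HasMFDerivAt 𝓘(ℝ, E) 𝓘(ℝ, E) ψ ((f ∘ φ.symm) (φ p))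
        (ContinuousLinearMap.id ℝ E) := by
      have h := (mdifferentiableAt_extChartAt (I := 𝓘(ℝ, E))
        (mem_chart_source E (f p))).hasMFDerivAt
      rw [mfderiv_extChartAt_self] at h
      rw [Function.comp_apply, hφp]
      exact h
    have d := hasMFDerivAt_iff_hasFDerivAt.1
      (HasMFDerivAt.comp (φ p) d3 (HasMFDerivAt.comp (φ p) d2 d1))
    exact congrArg (fun L : E →L[ℝ] E ↦ L a) (HasFDerivAt.fderiv d)
  have hreg : CoordMetric.IsRegularAt (g.inChart (f p)) (F (φ p)) := by
    rw [hFp]; exact g.isRegularAt_inChart_self (f p)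
  have hcurv := CoordMetric.fderiv_curvature_pullback (g.isRegularAt_inChart_self p) hreg
    (hsmooth.of_le (by norm_cast)) hpull u v z
  rw [riemann_eq, riemann_eq, ← hφ, ← hψ, ← hFp]
  refine Eq.trans ?_ (hpull.self_of_nhds _ _).symm
  rw [hcurv, hDF u, hDF v, hDF z, hDF w]

end LorentzianMetric

/-! ### The curvature tensor as a continuous multilinear form, and its symmetries -/

namespace CoordMetric

variable {E : Type*} [NormedAddCommGroup E] [NormedSpace ℝ E]

/-- The curvature operator as a bundled trilinear map. -/
def curvatureL (G : E → E →L[ℝ] E →L[ℝ] ℝ) (y : E) : E →L[ℝ] E →L[ℝ] E →L[ℝ] E :=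
  let A : E →L[ℝ] E →L[ℝ] E →L[ℝ] E := fderiv ℝ (christoffelL G) y +
    (ContinuousLinearMap.compL ℝ E E E).bilinearComp (christoffelL G y) (christoffelL G y)
  A - A.flip

theorem IsRegularAt.curvatureL_apply [CompleteSpace E] {G : E → E →L[ℝ] E →L[ℝ] ℝ} {y : E}
    (h : IsRegularAt G y) (u v z : E) : curvatureL G y u v z = curvature G y u v z := by
  rw [h.curvature_eq]
  rfl

end CoordMetric

namespace LorentzianMetric

variable {E : Type*} [NormedAddCommGroup E] [NormedSpace ℝ E]
  {M : Type*} [TopologicalSpace M] [ChartedSpace E M] [IsManifold 𝓘(ℝ, E) ∞ M]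
  (g : LorentzianMetric E M)

/-- The Riemann curvature tensor as a bundled multilinear form. -/
def riemannL (p : M) : E →L[ℝ] E →L[ℝ] E →L[ℝ] E →L[ℝ] ℝ :=
  (ContinuousLinearMap.compL ℝ E (E →L[ℝ] E) (E →L[ℝ] E →L[ℝ] ℝ)
    (ContinuousLinearMap.compL ℝ E E (E →L[ℝ] ℝ)
      (g.inChart p (extChartAt 𝓘(ℝ, E) p p)))) ∘L
    CoordMetric.curvatureL (g.inChart p) (extChartAt 𝓘(ℝ, E) p p)

theorem exists_unit_timelike (p : M) : ∃ e : TangentSpace 𝓘(ℝ, E) p, g.inner p e e = -1 ∧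
    ∀ w : TangentSpace 𝓘(ℝ, E) p, g.inner p e w = 0 → w ≠ 0 → 0 < g.inner p w w := by
  obtain ⟨e, he, hpos⟩ := g.lorentzian p
  have hs : 0 < √(-g.inner p e e) := Real.sqrt_pos.2 (by linarith)
  have hss : √(-g.inner p e e) * √(-g.inner p e e) = -g.inner p e e :=
    Real.mul_self_sqrt (by linarith)
  refine ⟨(√(-g.inner p e e))⁻¹ • e, ?_, fun w hw ↦ hpos w ?_⟩
  · simp only [map_smul, smul_apply, smul_eq_mul]
    rw [← mul_assoc, ← mul_inv, hss, inv_neg, neg_mul, inv_mul_cancel₀ he.ne]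
  · simpa [hs.ne'] using hw

theorem riemann_swap_left (p : M) (u v z w : TangentSpace 𝓘(ℝ, E) p) :
    g.riemann p u v z w = -g.riemann p v u z w := by
  have h : ∀ (B : E →L[ℝ] E →L[ℝ] ℝ) (a b c : E), a = -b → B a c = -B b c := by
    rintro B _ b c rfl; simp
  rw [riemann_eq, riemann_eq]
  exact h _ _ _ _ (neg_sub _ _).symm

variable [FiniteDimensional ℝ E]

theorem riemannL_apply (p : M) (u v z w : TangentSpace 𝓘(ℝ, E) p) :
    g.riemannL p u v z w = g.riemann p u v z w := by
  rw [riemann_eq]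
  exact congrArg (fun x : E ↦ g.inChart p (extChartAt 𝓘(ℝ, E) p p) x w)
    ((g.isRegularAt_inChart_self p).curvatureL_apply u v z)

theorem riemann_swap_right (p : M) (u v z w : TangentSpace 𝓘(ℝ, E) p) :
    g.riemann p u v z w = -g.riemann p u v w z := by
  have skew : ∀ L : E →L[ℝ] E →L[ℝ] ℝ, (∀ x, L x x = 0) → ∀ a b, L a b = -L b a := by
    intro L hL a b
    have h := hL (a + b)
    simp only [map_add, add_apply, hL] at h
    linarith
  have h := skew (g.riemannL p u v) (fun x ↦
    (g.riemannL_apply p u v x x).trans ((g.riemann_eq p u v x x).trans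
      ((g.isRegularAt_inChart_self p).apply_curvature_self u v x))) z w
  rwa [← riemannL_apply, ← riemannL_apply]

/-! ### Consequences of transitivity on unit timelike vectors -/

variable {g}

/-- Transitivity on unit timelike vectors provides linear isometries between tangent spaces which
preserve the curvature tensor. -/
theorem LocalIsometriesTransitiveOn.exists_linear_isometry
    (hg : g.LocalIsometriesTransitiveOn g.unitTimelike) {p q : M} {ξ : TangentSpace 𝓘(ℝ, E) p}
    {η : TangentSpace 𝓘(ℝ, E) q} (hξ : g.inner p ξ ξ = -1) (hη : g.inner q η η = -1) :
    ∃ A : TangentSpace 𝓘(ℝ, E) p →L[ℝ] TangentSpace 𝓘(ℝ, E) q, A ξ = η ∧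
      (∀ u v, g.inner q (A u) (A v) = g.inner p u v) ∧
      ∀ u v z w, g.riemann q (A u) (A v) (A z) (A w) = g.riemann p u v z w := by
  obtain ⟨f, hf, hp, h⟩ := hg ⟨p, ξ⟩ hξ ⟨q, η⟩ hη
  -- Stated for an arbitrary point of the tangent bundle so that the equality can be substituted,
  -- with no transport along `f p = q`.
  have key : ∀ η' : TangentBundle 𝓘(ℝ, E) M,
      tangentMap 𝓘(ℝ, E) 𝓘(ℝ, E) f ⟨p, ξ⟩ = η' →
      ∃ A : TangentSpace 𝓘(ℝ, E) p →L[ℝ] TangentSpace 𝓘(ℝ, E) η'.proj, A ξ = η'.snd ∧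
      (∀ u v, g.inner η'.proj (A u) (A v) = g.inner p u v) ∧
      ∀ u v z w, g.riemann η'.proj (A u) (A v) (A z) (A w) = g.riemann p u v z w := by
    rintro _ rfl
    exact ⟨mfderiv 𝓘(ℝ, E) 𝓘(ℝ, E) f p, rfl, hf.inner_map p hp, hf.riemann_map hp⟩
  exact key _ h

/-- Transitivity on unit timelike vectors bounds the sectional curvature of timelike planes. -/
theorem LocalIsometriesTransitiveOn.exists_timelike_bound
    (hg : g.LocalIsometriesTransitiveOn g.unitTimelike) (p : M) :
    ∃ C, ∀ u y : TangentSpace 𝓘(ℝ, E) p, g.inner p u u < 0 → g.inner p u y = 0 →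
      |g.riemann p y u u y| ≤ C * (g.inner p y y * -(g.inner p u u)) := by
  obtain ⟨e, he, hpos⟩ := g.exists_unit_timelike p
  obtain ⟨C, hC⟩ := exists_quadratic_le_mul_of_pos_orthogonal (V := E) (B := g.inner p)
    (e := e) (((g.riemannL p).flip e).flip e) hpos
  refine ⟨C, fun u y hu huy ↦ ?_⟩
  -- Both sides of the bound are quadratic in `u`, so `u` may be normalized and then carried to `e`
  -- by a linear isometry.
  obtain ⟨s, u, rfl, hs, hu1⟩ : ∃ (s : ℝ) (u' : TangentSpace 𝓘(ℝ, E) p), u = s • u' ∧ s ≠ 0 ∧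
      g.inner p u' u' = -1 := by
    have hs : 0 < √(-g.inner p u u) := Real.sqrt_pos.2 (by linarith)
    have hss : √(-g.inner p u u) * √(-g.inner p u u) = -g.inner p u u :=
      Real.mul_self_sqrt (by linarith)
    refine ⟨√(-g.inner p u u), (√(-g.inner p u u))⁻¹ • u, ?_, hs.ne', ?_⟩
    · rw [smul_smul, mul_inv_cancel₀ hs.ne', one_smul]
    · simp only [map_smul, smul_apply, smul_eq_mul]
      rw [← mul_assoc, ← mul_inv, hss, inv_neg, neg_mul, inv_mul_cancel₀ hu.ne]
  obtain ⟨A, hA, hAg, hAR⟩ := hg.exists_linear_isometry hu1 he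
  have huy' : g.inner p u y = 0 := by simpa [hs] using huy
  have h : |g.riemann p (A y) e e (A y)| ≤ C * g.inner p (A y) (A y) := by
    rw [← riemannL_apply]
    exact hC (A y) (by rw [← hA]; exact (hAg u y).trans huy')
  rw [← hA, hAR, hAg] at h
  have hscale : g.riemann p y (s • u) (s • u) y = s * (s * g.riemann p y u u y) := by
    have h : ∀ (R : E →L[ℝ] E →L[ℝ] E →L[ℝ] E →L[ℝ] ℝ) (a b : E),
        R a (s • b) (s • b) a = s * (s * R a b b a) := by
      intro R a b
      simp only [map_smul, smul_apply, smul_eq_mul]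
    rw [← riemannL_apply, ← riemannL_apply]
    exact h _ _ _
  rw [hscale, ← mul_assoc, abs_mul, abs_of_nonneg (mul_self_nonneg s)]
  simp only [map_smul, smul_apply, smul_eq_mul, hu1]
  calc s * s * |g.riemann p y u u y| ≤ s * s * (C * g.inner p y y) :=
        mul_le_mul_of_nonneg_left h (mul_self_nonneg s)
    _ = _ := by ring

theorem LocalIsometriesTransitiveOn.hasConstantSectionalCurvature [Nonempty M]
    (hg : g.LocalIsometriesTransitiveOn g.unitTimelike) : g.HasConstantSectionalCurvature := by
  obtain ⟨q⟩ := ‹Nonempty M›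
  obtain ⟨η, hη, hpos⟩ := g.exists_unit_timelike q
  obtain ⟨C, hC⟩ := hg.exists_timelike_bound q
  obtain ⟨k, hk⟩ := exists_const_sectional_of_timelike_bound (V := E) (B := g.inner q)
    (R := g.riemannL q) (e := η) (C := C) (g.symm q) hη hpos
    (fun u v z w ↦ (g.riemannL_apply q u v z w).trans ((g.riemann_swap_left q u v z w).trans
      (congrArg Neg.neg (g.riemannL_apply q v u z w).symm)))
    (fun u v z w ↦ (g.riemannL_apply q u v z w).trans ((g.riemann_swap_right q u v z w).trans
      (congrArg Neg.neg (g.riemannL_apply q u v w z).symm)))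
    (fun u y hu huy ↦ (congrArg abs (g.riemannL_apply q y u u y)).trans_le (hC u y hu huy))
  -- The value `k` found at `q` is pulled back to `p` by an isometry that matches some unit timelike
  -- vector at `p` with `η`.
  refine ⟨k, fun p u v huv ↦ ?_⟩
  obtain ⟨ξ, hξ, -⟩ := g.exists_unit_timelike p
  obtain ⟨A, -, hAg, hAR⟩ := hg.exists_linear_isometry hξ hη
  have h : g.riemann q (A u) (A v) (A v) (A u) = k * (g.inner q (A u) (A u) *
      g.inner q (A v) (A v) - g.inner q (A u) (A v) ^ 2) := by
    rw [← riemannL_apply]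
    exact hk (A u) (A v)
  rw [hAR, hAg, hAg, hAg] at h
  rw [sectionalCurvature, h]
  exact mul_div_cancel_right₀ k huv

end LorentzianMetric
end

theorem theorem1p4 {E : Type*} [NormedAddCommGroup E] [NormedSpace ℝ E] [FiniteDimensional ℝ E]
    {M : Type*} [TopologicalSpace M] [ChartedSpace E M] [IsManifold 𝓘(ℝ, E) ∞ M]
    [ConnectedSpace M] (g : LorentzianMetric E M) (hg : g.IsLocalTwoPointHomogeneous) :
    g.HasConstantSectionalCurvature :=
  hg.1.hasConstantSectionalCurvature
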